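/- Let $k$ be a commutative ring and let $\mathsf C$ be a $k$-linear abelian category in which every object has finite length, every morphism set $\operatorname{Hom}(X,Y)$ has finite length as a $k$-module, and there are only finitely many isomorphism classes of simple objects. A character for $\mathsf C$ is a function $\chi\colon\operatorname{Ob}\mathsf C\to\mathbb N=\{0,1,2,\dots\}$ such that $\chi(X\oplus Y)=\chi(X)+\chi(Y)$ for all objects $X,Y$, and $\chi(X)+\chi(Z)\ge\chi(Y)$ for each exact sequence $X\to Y\to Z\to 0$. A character $\chi\ne 0$ is irreducible if it is not a sum of two non-zero characters. Let $\operatorname{Sp}\mathsf C$ be the set of irreducible characters. The degree of $\chi$ is $\deg\chi=\sum_S\chi(S)$, where $S$ runs through a representative set of the simple objects. For a morphism $\alpha\colon X\to Y$ and $n\in\mathbb N$ put $\chi(\alpha)=\chi(X)-\chi(Y)+\chi(\operatorname{Coker}\alpha)$ and $$\mathsf U_\alpha=\{\chi\in\operatorname{Sp}\mathsf C\mid\chi(\alpha)\neq 0\},\quad \mathsf V_{\alpha,n}=\{\chi\in\operatorname{Sp}\mathsf C\mid\chi(\alpha)\le n\},\quad \mathsf V_n=\{\chi\in\operatorname{Sp}\mathsf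 C\mid\deg\chi\le n\}.$$ Then the sets $\mathsf U_\alpha$, where $\alpha$ runs through all morphisms in $\mathsf C$, form a basis of open sets for a topology on $\operatorname{Sp}\mathsf C$. With respect to this topology, the sets $\mathsf V_{\alpha,n}$ are closed for all morphisms $\alpha$ and all $n\in\mathbb N$, and for each $n\in\mathbb N$ the set $\mathsf V_n$ is closed and compact (every open cover has a finite subcover; no separation axiom is claimed). -/

import Mathlib

open CategoryTheory CategoryTheory.Limits

universe v u w

section CharacterDefs

variable (C : Type u) [Category.{v} C] [Abelian C]

/-- A character for an abelian category: a function from objects to `ℕ` which is additive on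
direct sums and satisfies `χ Y ≤ χ X + χ Z` for each exact sequence `X ⟶ Y ⟶ Z ⟶ 0`. -/
@[ext]
structure Character where
  toFun : C → ℕ
  map_biprod : ∀ X Y : C, toFun (X ⊞ Y) = toFun X + toFun Y
  le_of_exact : ∀ S : ShortComplex C, S.Exact → Epi S.g →
    toFun S.X₂ ≤ toFun S.X₁ + toFun S.X₃

namespace Character

instance : CoeFun (Character C) (fun _ => C → ℕ) := ⟨Character.toFun⟩

/-- The zero character. -/
instance : Zero (Character C) where
  zero :=
    { toFun := fun _ => 0
      map_biprod := fun _ _ => rfl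
      le_of_exact := fun _ _ _ => le_rfl }

/-- The pointwise sum of two characters. -/
instance : Add (Character C) where
  add φ ψ :=
    { toFun := fun X => φ X + ψ X
      map_biprod := fun X Y => by
        have h₁ := φ.map_biprod X Y
        have h₂ := ψ.map_biprod X Y
        lia
      le_of_exact := fun S hS hg => by
        have h₁ := φ.le_of_exact S hS hg
        have h₂ := ψ.le_of_exact S hS hg
        lia }

variable {C}

/-- A character is irreducible if it is non-zero and not a sum of two non-zero characters. -/
def IsIrreducible (χ : Character C) : Prop :=
  χ ≠ 0 ∧ ¬ ∃ φ ψ : Character C, φ ≠ 0 ∧ ψ ≠ 0 ∧ χ = φ + ψ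

/-- The value `χ(α) = χ(X) - χ(Y) + χ(Coker α)` of a character at a morphism `α : X ⟶ Y`. -/
noncomputable def onHom (χ : Character C) {X Y : C} (α : X ⟶ Y) : ℤ :=
  (χ X : ℤ) - (χ Y : ℤ) + (χ (cokernel α) : ℤ)

end Character

/-- The isomorphism classes of simple objects. -/
def SimpleClass : Type u :=
  Quotient ((isIsomorphicSetoid C).comap (Subtype.val : {S : C // Simple S} → C))

variable {C}

/-- A representative of an isomorphism class of simple objects. -/
noncomputable def SimpleClass.rep (s : SimpleClass C) : C :=
  (Quotient.out s).1

/-- The degree of a character: the sum of its values over a representative set of simple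
objects (there being only finitely many isomorphism classes of them). -/
noncomputable def Character.degree [Finite (SimpleClass C)] (χ : Character C) : ℕ :=
  letI : Fintype (SimpleClass C) := Fintype.ofFinite _
  ∑ s : SimpleClass C, χ s.rep

variable (C)

/-- `Sp C`, the set of irreducible characters. -/
def Sp : Type u := {χ : Character C // χ.IsIrreducible}

variable {C}

namespace Sp

/-- The set `U_α` of irreducible characters with `χ(α) ≠ 0`. -/
def U {X Y : C} (α : X ⟶ Y) : Set (Sp C) := {χ | χ.1.onHom α ≠ 0}

/-- The set `V_{α,n}` of irreducible characters with `χ(α) ≤ n`. -/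
def VHom {X Y : C} (α : X ⟶ Y) (n : ℕ) : Set (Sp C) := {χ | χ.1.onHom α ≤ (n : ℤ)}

/-- The set `V_n` of irreducible characters of degree at most `n`. -/
def V [Finite (SimpleClass C)] (n : ℕ) : Set (Sp C) := {χ | χ.1.degree ≤ n}

variable (C) in
/-- The collection of all sets `U_α`, where `α` runs through all morphisms of `C`. -/
def basicOpens : Set (Set (Sp C)) := {W | ∃ (X Y : C) (α : X ⟶ Y), W = U α}

/-- The topology on `Sp C` generated by the sets `U_α`. -/
instance : TopologicalSpace (Sp C) := TopologicalSpace.generateFrom (basicOpens C)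

end Sp

end CharacterDefs

/-! View `α : X ⟶ Y` as the image of `Hom(Y,-) ⟶ Hom(X,-)`. Factoring preorders the morphisms out of
`X` by inclusion of images; `biprod.lift` gives sums and the pushout gives intersections. `rank`
measures images, is monotone and modular, and `rankDiff` measures the subquotients given by
intervals, with `onHom α` the value on the interval from `α` to `𝟙 X`.

Given a subadditive weight bounded by `χ`, maximize its total over finite filtrations of an
interval. Schreier refinement (`exists_split`) makes this supremum additive, so it defines a
character, and `χ` minus it is a character too. If `χ` is irreducible and the weight is not zero,
the two agree with `χ` and `0`, so `χ(β)` is attained by a filtration (`isFiltrationSum_onHom`).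
Weighing by support in `U α` gives the basis property; counting factors on which `χ` is nonzero
gives lower semicontinuity of `χ ↦ χ(β)`, hence closedness.

For compactness, values are bounded by the degree, so an ultrafilter on `V n` has a pointwise limit
character; the ultrafilter converges to any irreducible summand of it. -/

/-! ### Cokernels of joins, meets and composites -/

section CokernelIsos

variable {C : Type u} [Category.{v} C] [Abelian C]

lemma comp_inl_cokernel_lift {X Y Z : C} (β : X ⟶ Y) (γ : X ⟶ Z) :
    β ≫ biprod.inl ≫ cokernel.π (biprod.lift β γ) =
      -(γ ≫ biprod.inr ≫ cokernel.π (biprod.lift β γ)) := by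
  have h := (biprod.lift_eq (f := β) (g := γ) =≫ cokernel.π (biprod.lift β γ)).symm
  rwa [cokernel.condition, Preadditive.add_comp, Category.assoc, Category.assoc,
    add_eq_zero_iff_eq_neg] at h

/-- The cokernel of `(π_β, g) : Y ⟶ Coker β ⊞ Z` is the cokernel of `β ≫ g`. -/
noncomputable def cokernelLiftIso {X Y Z : C} (β : X ⟶ Y) (g : Y ⟶ Z) :
    cokernel (biprod.lift (cokernel.π β) g) ≅ cokernel (β ≫ g) where
  hom := cokernel.desc _
    (biprod.desc (-cokernel.desc β (g ≫ cokernel.π (β ≫ g)) (by simp [← Category.assoc]))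
      (cokernel.π (β ≫ g))) (by simp [biprod.lift_desc])
  inv := cokernel.desc _ (biprod.inr ≫ cokernel.π _) (by
    have h : β ≫ biprod.lift (cokernel.π β) g = β ≫ g ≫ biprod.inr := by
      ext <;> simp
    rw [Category.assoc, ← reassoc_of% h]
    simp)
  hom_inv_id := by
    rw [← cancel_epi (cokernel.π _)]
    apply biprod.hom_ext'
    · rw [← cancel_epi (cokernel.π β)]
      simp [comp_inl_cokernel_lift]
    · simp
  inv_hom_id := by
    rw [← cancel_epi (cokernel.π _)]
    simp

/-- The cokernel of `(β, γ) : X ⟶ Y ⊞ Z` is the pushout of `β` and `γ`. -/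
noncomputable def cokernelLiftIsoPushout {X Y Z : C} (β : X ⟶ Y) (γ : X ⟶ Z) :
    cokernel (biprod.lift β γ) ≅ pushout β γ where
  hom := cokernel.desc _ (biprod.desc (pushout.inl β γ) (-pushout.inr β γ))
    (by simp [biprod.lift_desc, pushout.condition])
  inv := pushout.desc (biprod.inl ≫ cokernel.π _) (-(biprod.inr ≫ cokernel.π _)) (by
    rw [comp_inl_cokernel_lift, Preadditive.comp_neg])
  hom_inv_id := by
    rw [← cancel_epi (cokernel.π _)]
    apply biprod.hom_ext' <;> simp [pushout.inl_desc, pushout.inr_desc]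
  inv_hom_id := by
    apply pushout.hom_ext <;> simp [pushout.inl_desc_assoc, pushout.inr_desc_assoc]

/-- The cokernel of the diagonal of the pushout of `β` and `γ` is `Coker β ⊞ Coker γ`. -/
noncomputable def cokernelCompInlIso {X Y Z : C} (β : X ⟶ Y) (γ : X ⟶ Z) :
    cokernel (β ≫ pushout.inl β γ) ≅ cokernel β ⊞ cokernel γ where
  hom := cokernel.desc _
    (pushout.desc (cokernel.π β ≫ biprod.inl) (cokernel.π γ ≫ biprod.inr) (by simp))
    (by simp [pushout.inl_desc])
  inv := biprod.desc
    (cokernel.desc β (pushout.inl β γ ≫ cokernel.π _) (by rw [← Category.assoc]; simp))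
    (cokernel.desc γ (pushout.inr β γ ≫ cokernel.π _) (by
      rw [← Category.assoc, ← pushout.condition]; simp))
  hom_inv_id := by
    rw [← cancel_epi (cokernel.π _)]
    apply pushout.hom_ext <;> simp [pushout.inl_desc_assoc, pushout.inr_desc_assoc]
  inv_hom_id := by
    apply biprod.hom_ext'
    · rw [← cancel_epi (cokernel.π β)]
      simp [pushout.inl_desc]
    · rw [← cancel_epi (cokernel.π γ)]
      simp [pushout.inr_desc]

/-- If the projection onto `Coker f` factors through `α`, then `Coker (f ≫ α)` is
`Coker α ⊞ Coker f`. -/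
noncomputable def cokernelCompIso {X Y Z : C} (f : X ⟶ Y) (α : Y ⟶ Z) (g : Z ⟶ cokernel f)
    (h : α ≫ g = cokernel.π f) : cokernel (f ≫ α) ≅ cokernel α ⊞ cokernel f where
  hom := cokernel.desc _ (biprod.lift (cokernel.π α) g) (by
    apply biprod.hom_ext <;> simp [h])
  inv := biprod.desc
    (cokernel.desc α (cokernel.π (f ≫ α) -
      g ≫ cokernel.desc f (α ≫ cokernel.π (f ≫ α)) (by simp [← Category.assoc]))
      (by simp [reassoc_of% h]))
    (cokernel.desc f (α ≫ cokernel.π (f ≫ α)) (by simp [← Category.assoc]))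
  hom_inv_id := by
    rw [← cancel_epi (cokernel.π _)]
    simp [biprod.lift_desc]
  inv_hom_id := by
    have h₁ : cokernel.desc f (α ≫ cokernel.π (f ≫ α)) (by simp [← Category.assoc]) ≫
        cokernel.desc (f ≫ α) (biprod.lift (cokernel.π α) g)
          (by apply biprod.hom_ext <;> simp [h]) = biprod.inr := by
      rw [← cancel_epi (cokernel.π f)]
      apply biprod.hom_ext <;> simp [h]
    apply biprod.hom_ext'
    · rw [← cancel_epi (cokernel.π α)]
      simp only [biprod.inl_desc_assoc, cokernel.π_desc_assoc, Preadditive.sub_comp,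
        Category.assoc, cokernel.π_desc, h₁]
      apply biprod.hom_ext <;> simp
    · simpa using h₁

end CokernelIsos

/-! ### The modular preorder of morphisms with fixed source, and ranks -/

section Rank

variable {C : Type u} [Category.{v} C]

/-- `FactorsThrough α β` says that `α` factors through `β`, for two morphisms with the same
source. -/
def FactorsThrough {X Y Z : C} (α : X ⟶ Y) (β : X ⟶ Z) : Prop := ∃ g : Z ⟶ Y, β ≫ g = α

namespace FactorsThrough

variable {X Y Z T : C} {α : X ⟶ Y} {β : X ⟶ Z} {γ : X ⟶ T}

lemma refl (α : X ⟶ Y) : FactorsThrough α α := ⟨𝟙 _, by simp⟩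

lemma trans (h : FactorsThrough α β) (h' : FactorsThrough β γ) : FactorsThrough α γ := by
  obtain ⟨g, rfl⟩ := h
  obtain ⟨g', rfl⟩ := h'
  exact ⟨g' ≫ g, by simp⟩

lemma comp_right (β : X ⟶ Z) (g : Z ⟶ Y) : FactorsThrough (β ≫ g) β := ⟨g, rfl⟩

lemma id (α : X ⟶ Y) : FactorsThrough α (𝟙 X) := ⟨α, by simp⟩

lemma precomp {W : C} (f : W ⟶ X) (h : FactorsThrough α β) :
    FactorsThrough (f ≫ α) (f ≫ β) := by
  obtain ⟨g, rfl⟩ := h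
  exact ⟨g, by simp⟩

end FactorsThrough

variable [Abelian C]

/-- The join of two morphisms with the same source. -/
noncomputable abbrev homSup {X Y Z : C} (α : X ⟶ Y) (β : X ⟶ Z) : X ⟶ Y ⊞ Z := biprod.lift α β

/-- The meet of two morphisms with the same source. -/
noncomputable abbrev homInf {X Y Z : C} (α : X ⟶ Y) (β : X ⟶ Z) : X ⟶ pushout α β :=
  α ≫ pushout.inl α β

namespace FactorsThrough

variable {X Y Z T : C} {α : X ⟶ Y} {β : X ⟶ Z} {γ : X ⟶ T}

lemma zero (α : X ⟶ Y) : FactorsThrough (0 : X ⟶ Z) α := ⟨0, by simp⟩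

lemma left_sup : FactorsThrough α (homSup α β) := ⟨biprod.fst, by simp⟩

lemma right_sup : FactorsThrough β (homSup α β) := ⟨biprod.snd, by simp⟩

lemma sup_le (h : FactorsThrough α γ) (h' : FactorsThrough β γ) :
    FactorsThrough (homSup α β) γ := by
  obtain ⟨g, rfl⟩ := h
  obtain ⟨g', rfl⟩ := h'
  exact ⟨biprod.lift g g', by ext <;> simp⟩

lemma inf_left : FactorsThrough (homInf α β) α := ⟨pushout.inl α β, rfl⟩

lemma inf_right : FactorsThrough (homInf α β) β := ⟨pushout.inr α β, pushout.condition.symm⟩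

lemma le_inf (h : FactorsThrough γ α) (h' : FactorsThrough γ β) :
    FactorsThrough γ (homInf α β) := by
  obtain ⟨g, rfl⟩ := h
  obtain ⟨g', h'⟩ := h'
  exact ⟨pushout.desc g g' h'.symm, by simp [pushout.inl_desc]⟩

end FactorsThrough

namespace Character

variable (χ : Character C)

lemma map_of_isZero {X : C} (hX : IsZero X) : χ X = 0 := by
  have le {Y Z : C} (hY : IsZero Y) (hZ : IsZero Z) : χ Z ≤ χ Y + χ Y :=
    χ.le_of_exact (ShortComplex.mk (0 : Y ⟶ Z) (0 : Z ⟶ Y) (by simp))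
      (ShortComplex.exact_of_isZero_X₂ _ hZ) (hY.epi _)
  -- Four copies yield `4a ≤ 2a`; two would only yield `2a ≤ 2a`.
  have hz : IsZero ((X ⊞ X) ⊞ (X ⊞ X)) := by
    simp only [biprod_isZero_iff, hX, and_self]
  have h := le hX hz
  simp only [map_biprod] at h
  lia

lemma map_iso {X Y : C} (e : X ≅ Y) : χ X = χ Y := by
  open ZeroObject in
  have le {X Y : C} (e : X ≅ Y) : χ Y ≤ χ X := by
    have h := χ.le_of_exact (ShortComplex.mk e.hom (0 : Y ⟶ (0 : C)) comp_zero)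
      ((ShortComplex.exact_iff_epi _ rfl).2 (inferInstanceAs (Epi e.hom)))
      ((isZero_zero C).epi _)
    simpa [χ.map_of_isZero (isZero_zero C)] using h
  exact le_antisymm (le e.symm) (le e)

lemma onHom_nonneg {X Y : C} (α : X ⟶ Y) : 0 ≤ χ.onHom α := by
  have h := χ.le_of_exact _ (ShortComplex.exact_cokernel α)
    (inferInstanceAs (Epi (cokernel.π α)))
  dsimp at h
  unfold onHom
  lia

/-- The value of a character on the image of `Hom(Y, -) ⟶ Hom(X, -)`, for `α : X ⟶ Y`. -/
noncomputable def rank {X Y : C} (α : X ⟶ Y) : ℤ := χ Y - χ (cokernel α)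

lemma onHom_eq {X Y : C} (α : X ⟶ Y) : χ.onHom α = χ X - χ.rank α := by
  unfold onHom rank
  lia

lemma rank_id (X : C) : χ.rank (𝟙 X) = χ X := by
  simp [rank, χ.map_of_isZero (isZero_cokernel_of_epi (𝟙 X))]

lemma rank_zero (X Y : C) : χ.rank (0 : X ⟶ Y) = 0 := by
  simp [rank, χ.map_iso (cokernelZeroIsoTarget (X := X) (Y := Y))]

/-- A difference of ranks is the value at one morphism. This gives monotonicity of `rank` and,
later, lets an interval define a basic open set. -/
lemma onHom_lift {X Y Z : C} (β : X ⟶ Y) (g : Y ⟶ Z) :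
    χ.onHom (biprod.lift (cokernel.π β) g) = χ.rank β - χ.rank (β ≫ g) := by
  rw [onHom, χ.map_iso (cokernelLiftIso β g), χ.map_biprod, rank, rank]
  push_cast
  ring

lemma rank_le {X Y Z : C} {α : X ⟶ Y} {β : X ⟶ Z} (h : FactorsThrough α β) :
    χ.rank α ≤ χ.rank β := by
  obtain ⟨g, rfl⟩ := h
  have h := χ.onHom_nonneg (biprod.lift (cokernel.π β) g)
  rw [onHom_lift] at h
  lia

lemma rank_eq {X Y Z : C} {α : X ⟶ Y} {β : X ⟶ Z} (h : FactorsThrough α β)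
    (h' : FactorsThrough β α) : χ.rank α = χ.rank β :=
  le_antisymm (χ.rank_le h) (χ.rank_le h')

/-- The value at the pushout occurs with opposite signs in the two ranks on the left and cancels. -/
lemma rank_sup_add_rank_inf {X Y Z : C} (α : X ⟶ Y) (β : X ⟶ Z) :
    χ.rank (homSup α β) + χ.rank (homInf α β) = χ.rank α + χ.rank β := by
  simp only [rank, χ.map_iso (cokernelLiftIsoPushout α β), χ.map_iso (cokernelCompInlIso α β),
    χ.map_biprod]
  push_cast
  ring

/-- Precomposition with `f` kills exactly the image of `cokernel.π f`; the hypothesis places that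
image inside the one of `α`, so the rank drops by a constant independent of `α`. -/
lemma rank_comp {X Y Z : C} (f : X ⟶ Y) {α : Y ⟶ Z} (h : FactorsThrough (cokernel.π f) α) :
    χ.rank (f ≫ α) = χ.rank α - χ (cokernel f) := by
  obtain ⟨g, h⟩ := h
  simp only [rank, χ.map_iso (cokernelCompIso f α g h), χ.map_biprod]
  push_cast
  ring

end Character

end Rank

/-! ### Weights and filtrations of intervals -/

section Filtration

variable {C : Type u} [Category.{v} C] [Abelian C]

/-- The values of all characters on the interval from `α` to `β`, for `α` factoring through
`β`. -/
noncomputable def rankDiff {X Y Z : C} (α : X ⟶ Y) (β : X ⟶ Z) : Character C → ℤ :=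
  fun χ => χ.rank β - χ.rank α

lemma rankDiff_nonneg {X Y Z : C} {α : X ⟶ Y} {β : X ⟶ Z} (h : FactorsThrough α β) :
    0 ≤ rankDiff α β :=
  fun χ => sub_nonneg.2 (χ.rank_le h)

lemma rankDiff_add {X Y Z T : C} (α : X ⟶ Y) (β : X ⟶ Z) (γ : X ⟶ T) :
    rankDiff α γ = rankDiff α β + rankDiff β γ := by
  ext χ
  simp only [rankDiff, Pi.add_apply]
  ring

/-- A weight: a function on the values of all characters, subadditive and bounded by the value
of the character `χ`. -/
structure Weight (χ : Character C) where
  toFun : (Character C → ℤ) → ℕ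
  map_add_le : ∀ u v, 0 ≤ u → 0 ≤ v → toFun (u + v) ≤ toFun u + toFun v
  le_apply : ∀ u, 0 ≤ u → (toFun u : ℤ) ≤ u χ

variable {χ : Character C} (W : Weight χ)

/-- `IsFiltrationSum W α β n` says that `n` is the sum of the weights of the factors of a finite
filtration of the interval from `α` to `β`. -/
inductive IsFiltrationSum {X : C} : ∀ {Y Z : C}, (X ⟶ Y) → (X ⟶ Z) → ℕ → Prop
  | single {Y Z : C} {α : X ⟶ Y} {β : X ⟶ Z} (h : FactorsThrough α β) :
      IsFiltrationSum α β (W.toFun (rankDiff α β))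
  | trans {Y Z T : C} {α : X ⟶ Y} {β : X ⟶ Z} {γ : X ⟶ T} {m n : ℕ}
      (h : IsFiltrationSum α β m) (h' : IsFiltrationSum β γ n) : IsFiltrationSum α γ (m + n)

namespace IsFiltrationSum

variable {W}

lemma factorsThrough {X Y Z : C} {α : X ⟶ Y} {β : X ⟶ Z} {n : ℕ}
    (h : IsFiltrationSum W α β n) : FactorsThrough α β := by
  induction h with
  | single h => exact h
  | trans _ _ h h' => exact h.trans h'

lemma le_rankDiff {X Y Z : C} {α : X ⟶ Y} {β : X ⟶ Z} {n : ℕ}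
    (h : IsFiltrationSum W α β n) : (n : ℤ) ≤ rankDiff α β χ := by
  induction h with
  | single h => exact W.le_apply _ (rankDiff_nonneg h)
  | @trans _ _ _ α β γ m n _ _ h h' =>
    rw [rankDiff_add α β γ, Pi.add_apply]
    push_cast
    lia

lemma zero {X Y Z : C} {α : X ⟶ Y} {β : X ⟶ Z} (h : FactorsThrough α β)
    (h' : FactorsThrough β α) : IsFiltrationSum W α β 0 := by
  have h₁ := single (W := W) h
  have h₂ := h₁.le_rankDiff
  rw [rankDiff, χ.rank_eq h h', sub_self] at h₂
  rwa [show W.toFun (rankDiff α β) = 0 by lia] at h₁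

lemma congr {X Y Z Y' Z' : C} {α : X ⟶ Y} {β : X ⟶ Z} {α' : X ⟶ Y'} {β' : X ⟶ Z'} {n : ℕ}
    (h : IsFiltrationSum W α β n) (hα : FactorsThrough α α') (hα' : FactorsThrough α' α)
    (hβ : FactorsThrough β β') (hβ' : FactorsThrough β' β) : IsFiltrationSum W α' β' n := by
  simpa using ((zero hα' hα).trans h).trans (zero hβ hβ')

/-- Filtrations of an interval can be transported along the join with `γ`. -/
lemma sup {X Y Z T : C} {α : X ⟶ Y} {β : X ⟶ Z} {n : ℕ} (h : IsFiltrationSum W α β n)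
    {γ : X ⟶ T} (hγ : FactorsThrough (homInf β γ) α) :
    IsFiltrationSum W (homSup α γ) (homSup β γ) n := by
  induction h with
  | @single _ _ α β h =>
    have h₁ : FactorsThrough (homSup α γ) (homSup β γ) :=
      .sup_le (h.trans .left_sup) .right_sup
    have h₂ : rankDiff α β = rankDiff (homSup α γ) (homSup β γ) := by
      ext ψ
      have e₁ := ψ.rank_sup_add_rank_inf α γ
      have e₂ := ψ.rank_sup_add_rank_inf β γ
      have e₃ : ψ.rank (homInf β γ) = ψ.rank (homInf α γ) :=
        ψ.rank_eq (.le_inf hγ .inf_right) (.le_inf (.trans .inf_left h) .inf_right)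
      simp only [rankDiff]
      lia
    rw [h₂]
    exact single h₁
  | trans h h' ih ih' =>
    exact (ih ((FactorsThrough.le_inf (.trans .inf_left h'.factorsThrough) .inf_right).trans
      hγ)).trans (ih' (hγ.trans h.factorsThrough))

/-- Filtrations of an interval can be transported along the meet with `γ`. -/
lemma inf {X Y Z T : C} {α : X ⟶ Y} {β : X ⟶ Z} {n : ℕ} (h : IsFiltrationSum W α β n)
    {γ : X ⟶ T} (hγ : FactorsThrough β (homSup α γ)) :
    IsFiltrationSum W (homInf α γ) (homInf β γ) n := by
  induction h with
  | @single _ _ α β h =>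
    have h₁ : FactorsThrough (homInf α γ) (homInf β γ) :=
      .le_inf (.trans .inf_left h) .inf_right
    have h₂ : rankDiff α β = rankDiff (homInf α γ) (homInf β γ) := by
      ext ψ
      have e₁ := ψ.rank_sup_add_rank_inf α γ
      have e₂ := ψ.rank_sup_add_rank_inf β γ
      have e₃ : ψ.rank (homSup β γ) = ψ.rank (homSup α γ) :=
        ψ.rank_eq (.sup_le hγ .right_sup) (.sup_le (h.trans .left_sup) .right_sup)
      simp only [rankDiff]
      lia
    rw [h₂]
    exact single h₁
  | trans h h' ih ih' =>
    exact (ih (h'.factorsThrough.trans hγ)).trans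
      (ih' (hγ.trans (.sup_le (h.factorsThrough.trans .left_sup) .right_sup)))

/-- A filtration of an interval can be refined so as to pass through a given intermediate
morphism. -/
lemma exists_split {X Y Z T : C} {α : X ⟶ Y} {β : X ⟶ Z} {n : ℕ} (h : IsFiltrationSum W α β n)
    {γ : X ⟶ T} (h₁ : FactorsThrough α γ) (h₂ : FactorsThrough γ β) :
    ∃ m₁ m₂, IsFiltrationSum W α γ m₁ ∧ IsFiltrationSum W γ β m₂ ∧ n ≤ m₁ + m₂ := by
  induction h generalizing T with
  | @single _ _ α β h =>
    refine ⟨_, _, single h₁, single h₂, ?_⟩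
    rw [rankDiff_add α γ β]
    exact W.map_add_le _ _ (rankDiff_nonneg h₁) (rankDiff_nonneg h₂)
  | @trans _ _ _ α δ β m n h h' ih ih' =>
    -- Cut the lower half at the meet of `δ` and `γ`, the upper half at their join. The two middle
    -- pieces, `b` and `c`, are then moved across the modular square so that they end or start at
    -- `γ`.
    obtain ⟨a, b, ha, hb, hab⟩ := ih (γ := homInf δ γ) (.le_inf h.factorsThrough h₁) .inf_left
    obtain ⟨c, d, hc, hd, hcd⟩ := ih' (γ := homSup δ γ) .left_sup
      (.sup_le h'.factorsThrough h₂)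
    have hb' : IsFiltrationSum W γ (homSup δ γ) b :=
      (hb.sup (γ := γ) (.refl _)).congr (.sup_le .inf_right (.refl _)) .right_sup
        (.refl _) (.refl _)
    have hc' : IsFiltrationSum W (homInf δ γ) γ c :=
      (hc.inf (γ := γ) (.refl _)).congr (.refl _) (.refl _) .inf_right
        (.le_inf .right_sup (.refl _))
    exact ⟨a + c, b + d, ha.trans hc', hb'.trans hd, by lia⟩

lemma precomp {X Y Z T : C} (f : X ⟶ Y) {α : Y ⟶ Z} {β : Y ⟶ T} {n : ℕ}
    (h : IsFiltrationSum W α β n) (hf : FactorsThrough (cokernel.π f) α) :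
    IsFiltrationSum W (f ≫ α) (f ≫ β) n := by
  induction h with
  | @single _ _ α β h =>
    have : rankDiff α β = rankDiff (f ≫ α) (f ≫ β) := by
      ext ψ
      simp [rankDiff, ψ.rank_comp f hf, ψ.rank_comp f (hf.trans h)]
    rw [this]
    exact single (h.precomp f)
  | trans h h' ih ih' => exact (ih hf).trans (ih' (hf.trans h.factorsThrough))

/-- Converse of `precomp`. The endpoints are fixed only up to mutual factoring, since an
intermediate term need not literally have the form `f ≫ _`. -/
lemma of_precomp {X Y Z T Z' T' : C} {f : X ⟶ Y} {γ : X ⟶ Z'} {δ : X ⟶ T'} {n : ℕ}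
    (h : IsFiltrationSum W γ δ n) {α : Y ⟶ Z} {β : Y ⟶ T}
    (hf : FactorsThrough (cokernel.π f) α) (hαβ : FactorsThrough α β)
    (h₁ : FactorsThrough γ (f ≫ α)) (h₁' : FactorsThrough (f ≫ α) γ)
    (h₂ : FactorsThrough δ (f ≫ β)) (h₂' : FactorsThrough (f ≫ β) δ) :
    IsFiltrationSum W α β n := by
  induction h generalizing Z T with
  | @single _ _ γ δ h =>
    have : rankDiff γ δ = rankDiff α β := by
      ext ψ
      simp [rankDiff, ψ.rank_eq h₁ h₁', ψ.rank_eq h₂ h₂', ψ.rank_comp f hf,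
        ψ.rank_comp f (hf.trans hαβ)]
    rw [this]
    exact single hαβ
  | @trans _ _ _ γ ε δ m n h h' ih ih' =>
    -- Lift `ε` to `β ≫ g`; joining with `α` puts the lift above `cokernel.π f` without changing its
    -- restriction along `f`.
    obtain ⟨g, hg⟩ := h'.factorsThrough.trans h₂
    have e₁ : FactorsThrough ε (f ≫ homSup α (β ≫ g)) := by
      have := (FactorsThrough.right_sup (α := α) (β := β ≫ g)).precomp f
      rwa [← Category.assoc, hg] at this
    have e₂ : FactorsThrough (f ≫ homSup α (β ≫ g)) ε := by
      have : f ≫ homSup α (β ≫ g) = homSup (f ≫ α) ε := by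
        apply biprod.hom_ext <;> simp [← hg]
      rw [this]
      exact .sup_le (h₁'.trans h.factorsThrough) (.refl _)
    exact (ih hf .left_sup h₁ h₁' e₁ e₂).trans
      (ih' (hf.trans .left_sup) (.sup_le hαβ (.comp_right _ _)) e₁ e₂ h₂ h₂')

end IsFiltrationSum

/-! ### The supremum over filtrations as a summand of the character -/

namespace Weight

/-- The maximal sum of weights of the factors of a finite filtration of the interval from `α`
to `β`. -/
noncomputable def sup {X Y Z : C} (α : X ⟶ Y) (β : X ⟶ Z) : ℕ :=
  sSup {n | IsFiltrationSum W α β n}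

section

variable {X Y Z T : C} {α : X ⟶ Y} {β : X ⟶ Z} {γ : X ⟶ T}

lemma bddAbove (α : X ⟶ Y) (β : X ⟶ Z) : BddAbove {n | IsFiltrationSum W α β n} :=
  ⟨(rankDiff α β χ).toNat, fun n hn => by
    have := hn.le_rankDiff
    lia⟩

variable {W} in
lemma le_sup {n : ℕ} (h : IsFiltrationSum W α β n) : n ≤ W.sup α β :=
  le_csSup (W.bddAbove α β) h

lemma isFiltrationSum_sup (h : FactorsThrough α β) : IsFiltrationSum W α β (W.sup α β) :=
  Nat.sSup_mem ⟨_, .single h⟩ (W.bddAbove α β)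

lemma sup_le_rankDiff (h : FactorsThrough α β) : (W.sup α β : ℤ) ≤ rankDiff α β χ :=
  (W.isFiltrationSum_sup h).le_rankDiff

lemma sup_add_sup (h : FactorsThrough α β) (h' : FactorsThrough β γ) :
    W.sup α β + W.sup β γ = W.sup α γ := by
  apply le_antisymm
  · exact le_sup ((W.isFiltrationSum_sup h).trans (W.isFiltrationSum_sup h'))
  · obtain ⟨m₁, m₂, h₁, h₂, hle⟩ := (W.isFiltrationSum_sup (h.trans h')).exists_split h h'
    exact hle.trans (add_le_add (le_sup h₁) (le_sup h₂))

lemma sup_precomp {X' : C} (f : X' ⟶ X) (hf : FactorsThrough (cokernel.π f) α)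
    (h : FactorsThrough α β) : W.sup (f ≫ α) (f ≫ β) = W.sup α β := by
  apply le_antisymm
  · exact le_sup ((W.isFiltrationSum_sup (h.precomp f)).of_precomp hf h (.refl _) (.refl _)
      (.refl _) (.refl _))
  · exact le_sup ((W.isFiltrationSum_sup h).precomp f hf)

end

/-- Split the interval of `X₁` at `f` and that of `X₂` at `g`. Precomposition with `g` matches `[0,
𝟙 X₃]` with `[0, g]`, and precomposition with `f` matches `[g, 𝟙 X₂]` with `[0, f]`. -/
lemma sup_add_sup_of_exact (S : ShortComplex C) (hS : S.Exact) (hg : Epi S.g) :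
    W.sup (0 : S.X₁ ⟶ S.X₁) (𝟙 S.X₁) + W.sup (0 : S.X₃ ⟶ S.X₃) (𝟙 S.X₃) =
      W.sup (0 : S.X₂ ⟶ S.X₂) (𝟙 S.X₂) + W.sup S.f (𝟙 S.X₁) := by
  have hπ : FactorsThrough (cokernel.π S.f) S.g :=
    ⟨hS.gIsCokernel.desc (CokernelCofork.ofπ _ (cokernel.condition S.f)),
      hS.gIsCokernel.fac _ WalkingParallelPair.one⟩
  have hz {X Y Z T : C} (α : X ⟶ T) : W.sup (0 : X ⟶ Y) α = W.sup (0 : X ⟶ Z) α := by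
    apply le_antisymm <;>
    exact le_sup ((W.isFiltrationSum_sup (.zero α)).congr (.zero _) (.zero _) (.refl _) (.refl _))
  have h₁ := W.sup_precomp S.g (α := (0 : S.X₃ ⟶ S.X₃)) (β := 𝟙 _)
    (by rw [cokernel.π_of_epi]; exact .zero _) (.id _)
  have h₂ := W.sup_precomp S.f (α := S.g) (β := 𝟙 _) hπ (.id _)
  have h₃ := W.sup_add_sup (α := (0 : S.X₁ ⟶ S.X₁)) (.zero S.f) (.id S.f)
  have h₄ := W.sup_add_sup (α := (0 : S.X₂ ⟶ S.X₂)) (.zero S.g) (.id S.g)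
  simp only [comp_zero, Category.comp_id, S.zero] at h₁ h₂
  rw [hz (Z := S.X₂)] at h₁
  rw [hz (Z := S.X₁)] at h₂
  lia

lemma sup_inl (X Y : C) : W.sup (biprod.inl : X ⟶ X ⊞ Y) (𝟙 X) = 0 := by
  have h := W.sup_le_rankDiff (.id (biprod.inl : X ⟶ X ⊞ Y))
  rw [rankDiff, χ.rank_eq (.id (biprod.inl : X ⟶ X ⊞ Y)) ⟨biprod.fst, by simp⟩] at h
  lia

lemma sup_biprod (X Y : C) : W.sup (0 : X ⊞ Y ⟶ X ⊞ Y) (𝟙 (X ⊞ Y)) =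
    W.sup (0 : X ⟶ X) (𝟙 X) + W.sup (0 : Y ⟶ Y) (𝟙 Y) := by
  have h := W.sup_add_sup_of_exact (ShortComplex.mk (biprod.inl : X ⟶ X ⊞ Y) biprod.snd (by simp))
    (ShortComplex.Splitting.ofHasBinaryBiproduct X Y).exact inferInstance
  dsimp at h
  rw [h, W.sup_inl, add_zero]

lemma sup_zero_id_le (X : C) : W.sup (0 : X ⟶ X) (𝟙 X) ≤ χ X := by
  have h := W.sup_le_rankDiff (.id (0 : X ⟶ X))
  rw [rankDiff, χ.rank_id, χ.rank_zero] at h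
  lia

/-- The character given by the maximal sums of weights. -/
noncomputable def character : Character C where
  toFun X := W.sup (0 : X ⟶ X) (𝟙 X)
  map_biprod X Y := W.sup_biprod X Y
  le_of_exact S hS hg := by
    have := W.sup_add_sup_of_exact S hS hg
    lia

/-- The difference of `χ` and the character given by the maximal sums of weights. -/
noncomputable def complement : Character C where
  toFun X := χ X - W.sup (0 : X ⟶ X) (𝟙 X)
  map_biprod X Y := by
    have h₁ := W.sup_zero_id_le X
    have h₂ := W.sup_zero_id_le Y
    rw [W.sup_biprod, χ.map_biprod]
    lia
  le_of_exact S hS hg := by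
    have h₁ := W.sup_add_sup_of_exact S hS hg
    -- The defect of exactness is the value on `[f, 𝟙 X₁]` for both functions, and there `χ`
    -- dominates the supremum.
    have h₂ := W.sup_le_rankDiff (.id S.f)
    have h₃ := W.sup_zero_id_le S.X₁
    have h₄ := W.sup_zero_id_le S.X₂
    have h₅ := W.sup_zero_id_le S.X₃
    have e : χ S.X₃ = χ (cokernel S.f) :=
      χ.map_iso (hS.gIsCokernel.coconePointUniqueUpToIso (colimit.isColimit _))
    rw [rankDiff, χ.rank_id, Character.rank, ← e] at h₂
    lia

lemma character_add_complement : χ = W.character + W.complement := by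
  ext X
  exact (Nat.add_sub_cancel' (W.sup_zero_id_le X)).symm

/-- For an irreducible character `χ` and a weight not vanishing identically, every `α` has a
filtration whose weights add up to `χ(α)`. -/
theorem isFiltrationSum_onHom (hχ : χ.IsIrreducible) {X Y : C} {α : X ⟶ Y}
    (hα : W.toFun (rankDiff α (𝟙 X)) ≠ 0) {X' Y' : C} (β : X' ⟶ Y') :
    IsFiltrationSum W β (𝟙 X') (χ.onHom β).toNat := by
  have h₀ : W.character ≠ 0 := fun h => by
    have h₁ : W.sup (0 : X ⟶ X) (𝟙 X) = 0 := congrArg (fun φ : Character C => φ X) h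
    have h₂ := le_sup (IsFiltrationSum.single (W := W) (.id α))
    have h₃ := W.sup_add_sup (α := (0 : X ⟶ X)) (.zero α) (.id α)
    lia
  have h₁ : W.complement = 0 := by
    by_contra h
    exact hχ.2 ⟨_, _, h₀, h, W.character_add_complement⟩
  have h₂ (Z : C) : W.sup (0 : Z ⟶ Z) (𝟙 Z) = χ Z := by
    have := congrArg (fun φ : Character C => φ Z) h₁
    exact le_antisymm (W.sup_zero_id_le Z) (Nat.le_of_sub_eq_zero this)
  have h₃ := W.sup_add_sup_of_exact _ (ShortComplex.exact_cokernel β)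
    (inferInstanceAs (Epi (cokernel.π β)))
  dsimp at h₃
  simp only [h₂] at h₃
  have h₄ : (χ.onHom β).toNat = W.sup β (𝟙 X') := by
    unfold Character.onHom
    lia
  rw [h₄]
  exact W.isFiltrationSum_sup (.id β)

end Weight

end Filtration

/-! ### Basis property and semicontinuity -/

section Topology

variable {C : Type u} [Category.{v} C] [Abelian C]

/-- For `δ` factoring through `γ`, the values on the interval from `δ` to `γ` are the values at a
single morphism. -/
lemma exists_onHom_eq_rankDiff {X Y Z : C} {α : X ⟶ Y} {β : X ⟶ Z} (h : FactorsThrough α β) :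
    ∃ (V W : C) (ε : V ⟶ W), ∀ ψ : Character C, ψ.onHom ε = rankDiff α β ψ := by
  obtain ⟨g, rfl⟩ := h
  exact ⟨_, _, biprod.lift (cokernel.π β) g, fun ψ => ψ.onHom_lift β g⟩

lemma rankDiff_id {X Y : C} (α : X ⟶ Y) (ψ : Character C) :
    rankDiff α (𝟙 X) ψ = ψ.onHom α := by
  rw [rankDiff, ψ.rank_id, ψ.onHom_eq]

open Classical in
/-- The weight counting the intervals on which `χ` does not vanish. -/
noncomputable def countingWeight (χ : Character C) : Weight χ where
  toFun u := if u χ = 0 then 0 else 1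
  map_add_le u v hu hv := by
    have h₁ : 0 ≤ u χ := hu χ
    have h₂ : 0 ≤ v χ := hv χ
    rw [Pi.add_apply]
    split_ifs <;> lia
  le_apply u hu := by
    have h₁ : 0 ≤ u χ := hu χ
    split_ifs <;> lia

open Classical in
/-- The weight with value `χ` on the intervals whose support is contained in that of `α`. -/
noncomputable def supportWeight (χ : Character C) {X Y : C} (α : X ⟶ Y) : Weight χ where
  toFun u := if ∀ ψ : Character C, ψ.onHom α = 0 → u ψ = 0 then (u χ).toNat else 0
  map_add_le u v hu hv := by
    have h₁ : 0 ≤ u χ := hu χ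
    have h₂ : 0 ≤ v χ := hv χ
    by_cases h : ∀ ψ : Character C, ψ.onHom α = 0 → (u + v) ψ = 0
    -- Both terms are nonnegative, so wherever the sum vanishes each term does.
    · have hu' : ∀ ψ : Character C, ψ.onHom α = 0 → u ψ = 0 := fun ψ hψ => by
        have e₁ : 0 ≤ u ψ := hu ψ
        have e₂ : 0 ≤ v ψ := hv ψ
        have e₃ := h ψ hψ
        rw [Pi.add_apply] at e₃
        lia
      have hv' : ∀ ψ : Character C, ψ.onHom α = 0 → v ψ = 0 := fun ψ hψ => by
        have e₃ := h ψ hψ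
        rwa [Pi.add_apply, hu' ψ hψ, zero_add] at e₃
      rw [if_pos h, if_pos hu', if_pos hv', Pi.add_apply]
      lia
    · rw [if_neg h]
      exact Nat.zero_le _
  le_apply u hu := by
    have h₁ : 0 ≤ u χ := hu χ
    split_ifs <;> lia

lemma IsFiltrationSum.exists_single_ne_zero {χ : Character C} {W : Weight χ} {X Y Z : C}
    {α : X ⟶ Y} {β : X ⟶ Z} {n : ℕ} (h : IsFiltrationSum W α β n) (hn : n ≠ 0) :
    ∃ (V V' : C) (γ : X ⟶ V) (δ : X ⟶ V'), FactorsThrough γ δ ∧ rankDiff γ δ ≤ rankDiff α β ∧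
      W.toFun (rankDiff γ δ) ≠ 0 := by
  induction h with
  | @single _ _ α β h => exact ⟨_, _, α, β, h, le_rfl, hn⟩
  | @trans _ _ _ α β γ m n h h' ih ih' =>
    rw [rankDiff_add α β γ]
    by_cases hm : m = 0
    · obtain ⟨V, V', δ, ε, h₁, h₂, h₃⟩ := ih' (by lia)
      exact ⟨V, V', δ, ε, h₁,
        h₂.trans (le_add_of_nonneg_left (rankDiff_nonneg h.factorsThrough)), h₃⟩
    · obtain ⟨V, V', δ, ε, h₁, h₂, h₃⟩ := ih hm
      exact ⟨V, V', δ, ε, h₁,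
        h₂.trans (le_add_of_nonneg_right (rankDiff_nonneg h'.factorsThrough)), h₃⟩

namespace Sp

lemma isOpen_U {X Y : C} (α : X ⟶ Y) : IsOpen (U α) :=
  TopologicalSpace.isOpen_generateFrom_of_mem ⟨X, Y, α, rfl⟩

/-- A filtration of the interval of `β` attaining `χ(β)` for the weight of `α` has a factor of
nonzero weight. Its support lies in `U α` by the choice of weight and in `U β` because its values
are at most those of `β`. -/
lemma exists_mem_U_subset_inter {X Y X' Y' : C} (α : X ⟶ Y) (β : X' ⟶ Y') {χ : Sp C}
    (hα : χ ∈ U α) (hβ : χ ∈ U β) :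
    ∃ (V V' : C) (ε : V ⟶ V'), χ ∈ U ε ∧ U ε ⊆ U α ∩ U β := by
  have hα' : χ.1.onHom α ≠ 0 := hα
  have hβ' : χ.1.onHom β ≠ 0 := hβ
  have h₁ := χ.1.onHom_nonneg α
  have h₂ := χ.1.onHom_nonneg β
  have hW : (supportWeight χ.1 α).toFun (rankDiff α (𝟙 X)) ≠ 0 := by
    have h : ∀ ψ : Character C, ψ.onHom α = 0 → rankDiff α (𝟙 X) ψ = 0 := fun ψ hψ => by
      rw [rankDiff_id, hψ]
    simp only [supportWeight, if_pos h]
    rw [rankDiff_id]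
    lia
  obtain ⟨V, V', γ, δ, h, hle, hne⟩ :=
    ((supportWeight χ.1 α).isFiltrationSum_onHom χ.2 hW β).exists_single_ne_zero (by lia)
  obtain ⟨T, T', ε, hε⟩ := exists_onHom_eq_rankDiff h
  simp only [supportWeight, ne_eq, ite_eq_right_iff, not_forall, ← hε] at hne
  obtain ⟨hsupp, hne⟩ := hne
  refine ⟨T, T', ε, fun h => hne (by rw [h]; rfl), fun ψ hψ => ⟨fun h => hψ (hsupp _ h), ?_⟩⟩
  intro h
  have h₃ := hle ψ.1
  rw [rankDiff_id, h, ← hε] at h₃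
  exact hψ (le_antisymm h₃ (ψ.1.onHom_nonneg ε))

/-- Each counted factor is nonzero at `χ`, hence at least `1` on a basic neighbourhood; intersect
these. -/
lemma exists_isOpen_le_rankDiff {χ : Sp C} {X Y Z : C} {α : X ⟶ Y} {β : X ⟶ Z} {n : ℕ}
    (h : IsFiltrationSum (countingWeight χ.1) α β n) :
    ∃ O : Set (Sp C), IsOpen O ∧ χ ∈ O ∧ ∀ ψ ∈ O, (n : ℤ) ≤ rankDiff α β ψ.1 := by
  induction h with
  | @single _ _ α β h =>
    obtain ⟨V, V', ε, hε⟩ := exists_onHom_eq_rankDiff h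
    by_cases hχ : rankDiff α β χ.1 = 0
    · exact ⟨Set.univ, isOpen_univ, trivial, fun ψ _ => by
        simpa [countingWeight, hχ] using rankDiff_nonneg h ψ.1⟩
    · refine ⟨U ε, isOpen_U ε, fun h => hχ (by rw [← hε, h]), fun ψ hψ => ?_⟩
      have h₁ : ψ.1.onHom ε ≠ 0 := hψ
      have h₂ := ψ.1.onHom_nonneg ε
      rw [← hε]
      simp only [countingWeight, if_neg hχ]
      lia
  | @trans _ _ _ α β γ m n _ _ ih ih' =>
    obtain ⟨O, hO, hχ, h⟩ := ih
    obtain ⟨O', hO', hχ', h'⟩ := ih'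
    refine ⟨O ∩ O', hO.inter hO', ⟨hχ, hχ'⟩, fun ψ hψ => ?_⟩
    have h₁ := h ψ hψ.1
    have h₂ := h' ψ hψ.2
    rw [rankDiff_add α β γ, Pi.add_apply]
    push_cast
    lia

/-- The set of irreducible characters whose value at `α` is at least `χ(α)` is a neighbourhood
of `χ`. -/
lemma exists_isOpen_onHom_le (χ : Sp C) {X Y : C} (α : X ⟶ Y) :
    ∃ O : Set (Sp C), IsOpen O ∧ χ ∈ O ∧ ∀ ψ ∈ O, χ.1.onHom α ≤ ψ.1.onHom α := by
  by_cases hα : χ.1.onHom α = 0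
  · exact ⟨Set.univ, isOpen_univ, trivial, fun ψ _ => hα.trans_le (ψ.1.onHom_nonneg α)⟩
  have hW : (countingWeight χ.1).toFun (rankDiff α (𝟙 X)) ≠ 0 := by
    simp [countingWeight, rankDiff_id, hα]
  obtain ⟨O, hO, hχ, h⟩ :=
    exists_isOpen_le_rankDiff ((countingWeight χ.1).isFiltrationSum_onHom χ.2 hW α)
  refine ⟨O, hO, hχ, fun ψ hψ => ?_⟩
  have := h ψ hψ
  rw [rankDiff_id] at this
  have := χ.1.onHom_nonneg α
  lia

lemma isClosed_VHom {X Y : C} (α : X ⟶ Y) (n : ℕ) : IsClosed (VHom α n) := by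
  rw [← isOpen_compl_iff, isOpen_iff_forall_mem_open]
  intro χ hχ
  obtain ⟨O, hO, hχO, h⟩ := exists_isOpen_onHom_le χ α
  exact ⟨O, fun ψ hψ hle => hχ ((h ψ hψ).trans hle), hO, hχO⟩

end Sp

lemma Character.onHom_zero_self (χ : Character C) (X : C) : χ.onHom (0 : X ⟶ X) = χ X := by
  rw [onHom_eq, rank_zero, sub_zero]

lemma Character.exists_ne_zero {χ : Character C} (hχ : χ ≠ 0) : ∃ X, χ X ≠ 0 := by
  by_contra! h
  exact hχ (Character.ext (funext h))

namespace Sp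

variable (C) in
theorem isTopologicalBasis_basicOpens :
    TopologicalSpace.IsTopologicalBasis (basicOpens C) where
  exists_subset_inter := by
    rintro _ ⟨X, Y, α, rfl⟩ _ ⟨X', Y', β, rfl⟩ χ ⟨hα, hβ⟩
    obtain ⟨V, V', ε, h, h'⟩ := exists_mem_U_subset_inter α β hα hβ
    exact ⟨U ε, ⟨V, V', ε, rfl⟩, h, h'⟩
  sUnion_eq := by
    refine Set.eq_univ_of_forall fun χ => ?_
    obtain ⟨X, hX⟩ := Character.exists_ne_zero χ.2.1
    refine ⟨_, ⟨X, X, 0, rfl⟩, fun h => hX ?_⟩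
    rw [Character.onHom_zero_self] at h
    exact_mod_cast h
  eq_generateFrom := rfl

end Sp

/-! ### Finite length, degree and irreducible summands -/

/-- A quotient of a quotient `p : X ⟶ Y` by a non-zero subobject has a strictly larger kernel. -/
lemma kernelSubobject_lt_comp_cokernel {X Y S : C} (p : X ⟶ Y) [Epi p] (i : S ⟶ Y) (hi : i ≠ 0) :
    kernelSubobject p < kernelSubobject (p ≫ cokernel.π i) := by
  refine lt_of_le_of_ne (kernelSubobject_comp_le _ _) fun h => hi ?_
  have h₁ : kernel.ι (p ≫ cokernel.π i) ≫ p = 0 := by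
    rw [← kernelSubobject_arrow' (p ≫ cokernel.π i), Category.assoc,
      ← Subobject.ofLE_arrow h.ge, Category.assoc, kernelSubobject_arrow_comp, comp_zero,
      comp_zero]
  have h₃ : cokernel.π i ≫ Abelian.epiDesc (p ≫ cokernel.π i) p h₁ = 𝟙 Y := by
    rw [← cancel_epi p, ← Category.assoc, Abelian.comp_epiDesc, Category.comp_id]
  rw [← Category.comp_id i, ← h₃, cokernel.condition_assoc, zero_comp]

namespace Character

lemma exists_map_eq_map_rep (χ : Character C) {S : C} (hS : Simple S) :
    ∃ s : SimpleClass C, χ S = χ s.rep := by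
  refine ⟨Quotient.mk _ ⟨S, hS⟩, ?_⟩
  obtain ⟨e⟩ := Quotient.mk_out (s := (isIsomorphicSetoid C).comap
    (Subtype.val : {S : C // Simple S} → C)) ⟨S, hS⟩
  exact (χ.map_iso e).symm

/-- On an object of finite length, the values of characters are bounded in terms of their values
on simple objects. -/
lemma exists_map_le (hlength : ∀ X : C, IsNoetherianObject X ∧ IsArtinianObject X) (X : C) :
    ∃ N : ℕ, ∀ (χ : Character C) (c : ℕ), (∀ s : SimpleClass C, χ s.rep ≤ c) → χ X ≤ N * c := by
  have := (hlength X).1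
  -- Induct on the kernel of a quotient `X ⟶ Y`: ascending chains stop as `X` is Noetherian, and a
  -- simple subobject to divide out exists as `Y` is Artinian.
  suffices h : ∀ (A : Subobject X) (Y : C) (p : X ⟶ Y), Epi p → kernelSubobject p = A →
      ∃ N : ℕ, ∀ (χ : Character C) (c : ℕ), (∀ s : SimpleClass C, χ s.rep ≤ c) → χ Y ≤ N * c from
    h _ X (𝟙 X) inferInstance rfl
  intro A
  induction A using WellFoundedGT.induction with
  | ind A ih =>
    rintro Y p hp rfl
    by_cases hY : IsZero Y
    · exact ⟨0, fun χ c _ => by rw [χ.map_of_isZero hY, zero_mul]⟩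
    have := (hlength Y).2
    obtain ⟨S, hS⟩ := exists_simple_subobject hY
    have hS₀ : S.arrow ≠ 0 := fun h => Simple.not_isZero (S : C) (IsZero.of_mono_eq_zero _ h)
    obtain ⟨N, hN⟩ := ih _ (kernelSubobject_lt_comp_cokernel p S.arrow hS₀) _
      (p ≫ cokernel.π S.arrow) inferInstance rfl
    refine ⟨1 + N, fun χ c hc => ?_⟩
    have h₁ := χ.le_of_exact _ (ShortComplex.exact_cokernel S.arrow)
      (inferInstanceAs (Epi (cokernel.π S.arrow)))
    obtain ⟨s, hs⟩ := χ.exists_map_eq_map_rep hS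
    have h₂ := hc s
    have h₃ := hN χ c hc
    dsimp at h₁
    rw [add_mul, one_mul]
    lia

lemma onHom_add (φ ψ : Character C) {X Y : C} (α : X ⟶ Y) :
    (φ + ψ).onHom α = φ.onHom α + ψ.onHom α := by
  have h (Z : C) : (φ + ψ) Z = φ Z + ψ Z := rfl
  simp only [onHom, h]
  push_cast
  ring

variable [Finite (SimpleClass C)]

lemma map_rep_le_degree (χ : Character C) (s : SimpleClass C) : χ s.rep ≤ χ.degree :=
  letI : Fintype (SimpleClass C) := Fintype.ofFinite _
  Finset.single_le_sum (f := fun s : SimpleClass C => χ s.rep) (fun _ _ => Nat.zero_le _)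
    (Finset.mem_univ s)

lemma degree_add (φ ψ : Character C) : (φ + ψ).degree = φ.degree + ψ.degree :=
  Finset.sum_add_distrib

lemma degree_ne_zero (hlength : ∀ X : C, IsNoetherianObject X ∧ IsArtinianObject X)
    {χ : Character C} (hχ : χ ≠ 0) : χ.degree ≠ 0 := by
  obtain ⟨X, hX⟩ := exists_ne_zero hχ
  obtain ⟨N, hN⟩ := exists_map_le hlength X
  intro h
  have := hN χ χ.degree χ.map_rep_le_degree
  rw [h, mul_zero] at this
  lia

/-- Every non-zero character has an irreducible summand. -/
lemma exists_irreducible_summand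
    (hlength : ∀ X : C, IsNoetherianObject X ∧ IsArtinianObject X) (θ : Character C)
    (hθ : θ ≠ 0) : ∃ χ ρ : Character C, χ.IsIrreducible ∧ θ = χ + ρ := by
  induction hd : θ.degree using Nat.strong_induction_on generalizing θ with
  | _ d ih =>
    by_cases h : θ.IsIrreducible
    · exact ⟨θ, 0, h, rfl⟩
    · have h' : ∃ φ ψ : Character C, φ ≠ 0 ∧ ψ ≠ 0 ∧ θ = φ + ψ := by
        by_contra h'
        exact h ⟨hθ, h'⟩
      obtain ⟨φ, ψ, hφ, hψ, rfl⟩ := h'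
      have h₁ := degree_ne_zero hlength hψ
      rw [degree_add] at hd
      obtain ⟨χ, ρ, hχ, rfl⟩ := ih φ.degree (by lia) φ hφ rfl
      exact ⟨χ, ρ + ψ, hχ, Character.ext (funext fun X => Nat.add_assoc _ _ _)⟩

end Character

/-! ### Closedness and compactness of `V n` -/

namespace Sp

variable [Finite (SimpleClass C)]

lemma isClosed_V (n : ℕ) : IsClosed (V n : Set (Sp C)) := by
  rw [← isOpen_compl_iff, isOpen_iff_forall_mem_open]
  intro χ hχ
  choose O hO hχO h using fun s : SimpleClass C =>
    exists_isOpen_onHom_le χ (0 : s.rep ⟶ s.rep)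
  refine ⟨⋂ s, O s, fun ψ hψ hle => hχ (show χ.1.degree ≤ n from
    le_trans (Finset.sum_le_sum fun s _ => ?_) hle),
    isOpen_iInter_of_finite hO, Set.mem_iInter.2 hχO⟩
  have := h s ψ (Set.mem_iInter.1 hψ s)
  simp only [Character.onHom_zero_self] at this
  exact_mod_cast this

/-- The pointwise limit of an ultrafilter of characters that is eventually constant at each
object. -/
def limitCharacter (f : Ultrafilter (Sp C)) (m : C → ℕ)
    (hm : ∀ X, ∀ᶠ χ : Sp C in f, χ.1 X = m X) : Character C where
  toFun := m
  map_biprod X Y := by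
    obtain ⟨χ, ⟨h₁, h₂⟩, h₃⟩ := (((hm X).and (hm Y)).and (hm (X ⊞ Y))).exists
    rw [← h₁, ← h₂, ← h₃, χ.1.map_biprod]
  le_of_exact S hS hg := by
    obtain ⟨χ, ⟨h₁, h₂⟩, h₃⟩ := (((hm S.X₁).and (hm S.X₃)).and (hm S.X₂)).exists
    rw [← h₁, ← h₂, ← h₃]
    exact χ.1.le_of_exact S hS hg

theorem isCompact_V (hlength : ∀ X : C, IsNoetherianObject X ∧ IsArtinianObject X) (n : ℕ) :
    IsCompact (V n : Set (Sp C)) := by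
  rw [isCompact_iff_ultrafilter_le_nhds]
  intro f hf
  have hV : ∀ᶠ χ : Sp C in f, χ.1.degree ≤ n := Filter.le_principal_iff.1 hf
  have hex (X : C) : ∃ m : ℕ, ∀ᶠ χ : Sp C in f, χ.1 X = m := by
    obtain ⟨N, hN⟩ := Character.exists_map_le hlength X
    have hfin : ∀ᶠ χ : Sp C in f, χ.1 X ∈ Set.Iic (N * n) := by
      filter_upwards [hV] with χ hχ
      exact hN χ.1 n fun s => (χ.1.map_rep_le_degree s).trans hχ
    obtain ⟨m, _, hm⟩ := Ultrafilter.eq_pure_of_finite_mem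
      (f := f.map (fun χ : Sp C => χ.1 X)) (Set.finite_Iic _) hfin
    refine ⟨m, ?_⟩
    have : ({m} : Set ℕ) ∈ f.map (fun χ : Sp C => χ.1 X) := by
      rw [hm]
      exact rfl
    exact this
  choose m hm using hex
  set θ := limitCharacter f m hm
  have hdeg : ∀ᶠ χ : Sp C in f, χ.1.degree = θ.degree := by
    filter_upwards [Filter.eventually_all.2 fun s : SimpleClass C => hm s.rep] with χ hχ
    exact Finset.sum_congr rfl fun s _ => hχ s
  obtain ⟨χ₀, h₁, h₂⟩ := (hdeg.and hV).exists
  -- The limit shares its degree with some irreducible character, so it cannot vanish.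
  have hθ : θ ≠ 0 := fun h => Character.degree_ne_zero hlength χ₀.2.1 (by
    rw [h₁, h]
    exact Finset.sum_const_zero)
  obtain ⟨χ, ρ, hχ, hsum⟩ := Character.exists_irreducible_summand hlength θ hθ
  obtain ⟨η, rfl⟩ : ∃ η : Sp C, η.1 = χ := ⟨⟨χ, hχ⟩, rfl⟩
  refine ⟨η, ?_, ?_⟩
  · change η.1.degree ≤ n
    rw [h₁, hsum, Character.degree_add] at h₂
    lia
  -- If `η` is nonzero at `α`, so is `θ`, since `ρ` contributes nonnegatively; and `ψ(α) = θ(α)`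
  -- eventually because only three objects are involved.
  · rw [TopologicalSpace.nhds_generateFrom]
    refine le_iInf₂ fun O hO => Filter.le_principal_iff.2 ?_
    obtain ⟨hχO, X, Y, α, rfl⟩ := hO
    filter_upwards [hm X, hm Y, hm (cokernel α)] with ψ hX hY hZ hψ
    have e : ψ.1.onHom α = θ.onHom α := by
      rw [Character.onHom, hX, hY, hZ]
      rfl
    have h₃ : η.1.onHom α ≠ 0 := hχO
    have h₄ := η.1.onHom_nonneg α
    have h₅ := ρ.onHom_nonneg α
    rw [hψ, hsum, Character.onHom_add] at e
    lia

end Sp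

end Topology

theorem mainTheorem9 (k : Type w) [CommRing k] (C : Type u) [Category.{v} C] [Abelian C]
    [Linear k C]
    (hlength : ∀ X : C, IsNoetherianObject X ∧ IsArtinianObject X)
    (hhom : ∀ X Y : C, IsFiniteLength k (X ⟶ Y))
    [Finite (SimpleClass C)] :
    TopologicalSpace.IsTopologicalBasis (Sp.basicOpens C) ∧
    (∀ (X Y : C) (α : X ⟶ Y) (n : ℕ), IsClosed (Sp.VHom α n)) ∧
    (∀ n : ℕ, IsClosed (Sp.V n : Set (Sp C)) ∧ IsCompact (Sp.V n : Set (Sp C))) :=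
  ⟨Sp.isTopologicalBasis_basicOpens C, fun _ _ α n => Sp.isClosed_VHom α n,
    fun n => ⟨Sp.isClosed_V n, Sp.isCompact_V hlength n⟩⟩
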